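/- Fix $q\in(0,1)$. For $n\in\mathbb{N}$ and $a,b\in\mathbb{R}$ with $0<aq<1$, let $$p_n(x;a,b)={}_2\phi_1\left(\begin{matrix}q^{-n},\,abq^{n+1}\\ aq\end{matrix};q,qx\right)=\sum_{k=0}^{n}\frac{(q^{-n};q)_k\,(abq^{n+1};q)_k}{(aq;q)_k\,(q;q)_k}\,(qx)^k,\qquad (c;q)_k=\prod_{j=0}^{k-1}(1-cq^j),$$ be the little $q$-Jacobi polynomials. For nonzero real polynomials $p,r$ all of whose zeros are real, with zeros (counted with multiplicity) $\lambda_1(p)\le\dots\le\lambda_n(p)$ and $\lambda_1(r)\le\dots\le\lambda_m(r)$, write $p\prec r$ if either $m=n$ and $\lambda_1(p)<\lambda_1(r)<\lambda_2(p)<\lambda_2(r)<\dots<\lambda_n(p)<\lambda_n(r)$, or $m=n-1$ and $\lambda_1(p)<\lambda_1(r)<\lambda_2(p)<\dots<\lambda_{n-1}(p)<\lambda_{n-1}(r)<\lambda_n(p)$; in particular, $p\prec r$ includes the assertion that all zeros of $p$ and $r$ are real. Let $0<aq<1$, and let $q^2\le t_1,t_2\le 1$ with $t_1t_2\ne 1$.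 Then for every $n\in\mathbb{N}$: (i) for every $b\in\mathbb{R}$ with $0\le qb<1$, where in the case $b=0$ it is assumed in addition that $t_2\neq1$, $$p_n(x;a,t_1b)\prec p_n(x;t_2a,b);$$ (ii) for every $b<0$, if $t_1\ne 1$, then $$p_n(x;a,b)\prec p_n(x;a,t_1b).$$ -/

import Mathlib

open Polynomial

/-- The `q`-Pochhammer symbol `(a; q)_k = ∏_{j=0}^{k-1} (1 - a q^j)`. -/
noncomputable def qPochhammer (a q : ℝ) (k : ℕ) : ℝ :=
  ∏ j ∈ Finset.range k, (1 - a * q ^ j)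

/-- The terminating `q`-hypergeometric series `₂φ₁(q^{-n}, α; β; q, z)`, evaluated at a
polynomial `z`. -/
noncomputable def qHyp21 (n : ℕ) (α β q : ℝ) (z : ℝ[X]) : ℝ[X] :=
  ∑ k ∈ Finset.range (n + 1),
    C (qPochhammer (q ^ (-(n : ℤ))) q k * qPochhammer α q k /
      (qPochhammer β q k * qPochhammer q q k)) * z ^ k

/-- The little `q`-Jacobi polynomial `p_n(x; a, b | q) = ₂φ₁(q^{-n}, a b q^{n+1}; a q; q, q x)`. -/
noncomputable def littleQJacobi (n : ℕ) (a b q : ℝ) : ℝ[X] :=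
  qHyp21 n (a * b * q ^ (n + 1)) (a * q) q (C q * X)

/-- `x 0 ≤ x 1 ≤ ⋯ ≤ x (n - 1)` is the list of all zeros, with multiplicity, of the nonzero
real-rooted polynomial `p` of degree `n`. -/
def IsZeroList (p : ℝ[X]) {n : ℕ} (x : Fin n → ℝ) : Prop :=
  p ≠ 0 ∧ Monotone x ∧ p = C p.leadingCoeff * ∏ i, (X - C (x i))

/-- Strict interlacing `p ≺ r` of real-rooted polynomials: with the zeros `x` of `p` and `y` of `r`
in increasing order, either both have `n` zeros and `x₁ < y₁ < x₂ < y₂ < ⋯ < xₙ < yₙ`, or `p` has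
`m + 1` zeros, `r` has `m` zeros and `x₁ < y₁ < x₂ < ⋯ < xₘ < yₘ < xₘ₊₁`. -/
def StrictlyInterlaces (p r : ℝ[X]) : Prop :=
  (∃ (n : ℕ) (x y : Fin n → ℝ), IsZeroList p x ∧ IsZeroList r y ∧
    (∀ i, x i < y i) ∧ ∀ i j : Fin n, (i : ℕ) + 1 = j → y i < x j) ∨
  (∃ (m : ℕ) (x : Fin (m + 1) → ℝ) (y : Fin m → ℝ), IsZeroList p x ∧ IsZeroList r y ∧
    (∀ i, x i.castSucc < y i) ∧ ∀ i, y i < x i.succ)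

/-! ### The `q`-binomial series and its functional equation -/

/-! For `0 < aq < 1` and `bq < 1` the polynomials `p_n(x; a, b)` are orthogonal for positive masses
`(bq;q)_k (aq)^k / (q;q)_k` at the points `q^k` (`littleQJacobi_orthogonal`). Interlacing is then a
comparison of two such weights `u`, `v`, in the spirit of Markov's theorem but without
differentiating in a parameter.

If `v/u` increases with the lattice point `q^k`, every zero moves right: `x_i < y_i`
(`zero_lt_zero_of_weight_ratio`). If, after multiplication by squares of polynomials `A`, `B` of
degree at most one, `vB²/(uA²)` varies in the opposite direction, no zero reaches its neighbour:
`y_i < x_{i+1}` (`zero_lt_next_zero_of_weight_ratio`). Both follow by evaluating `(x - c) f²` with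
Gauss quadrature for a test polynomial `f` that removes the nodes on the wrong side.

For these weights both monotonicity conditions reduce to elementary inequalities, and `t₁, t₂ ≥ q²`
is what the second one needs. -/

theorem mul_pow_lt_one_of_lt_one {a q : ℝ} (ha : a < 1) (hq0 : 0 ≤ q) (hq1 : q ≤ 1) (j : ℕ) :
    a * q ^ j < 1 := by
  have h0 := pow_nonneg hq0 j
  have h1 := pow_le_one₀ (n := j) hq0 hq1
  rcases le_total a 0 with h | h
  · nlinarith
  · nlinarith

theorem qPochhammer_zero (a q : ℝ) : qPochhammer a q 0 = 1 := by
  simp [qPochhammer]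

theorem qPochhammer_succ (a q : ℝ) (k : ℕ) :
    qPochhammer a q (k + 1) = qPochhammer a q k * (1 - a * q ^ k) :=
  Finset.prod_range_succ _ _

theorem qPochhammer_add (a q : ℝ) (m k : ℕ) :
    qPochhammer a q (m + k) = qPochhammer a q m * qPochhammer (a * q ^ m) q k := by
  simp only [qPochhammer, Finset.prod_range_add, pow_add, mul_assoc]

theorem qPochhammer_pos {a q : ℝ} (ha : a < 1) (hq0 : 0 ≤ q) (hq1 : q ≤ 1) (k : ℕ) :
    0 < qPochhammer a q k :=
  Finset.prod_pos fun j _ => sub_pos.2 (mul_pow_lt_one_of_lt_one ha hq0 hq1 j)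

/-- The coefficient `(A; q)_k / (q; q)_k` of the `q`-binomial series. -/
noncomputable def qBinomialCoeff (A q : ℝ) (k : ℕ) : ℝ :=
  qPochhammer A q k / qPochhammer q q k

theorem qBinomialCoeff_succ {A q : ℝ} (hq0 : 0 < q) (hq1 : q < 1) (k : ℕ) :
    qBinomialCoeff A q (k + 1) * (1 - q ^ (k + 1)) = qBinomialCoeff A q k * (1 - A * q ^ k) := by
  have h1 := (qPochhammer_pos hq1 hq0.le hq1.le k).ne'
  have h2 : (1 - q * q ^ k) ≠ 0 := (sub_pos.2 (mul_pow_lt_one_of_lt_one hq1 hq0.le hq1.le k)).ne'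
  rw [qBinomialCoeff, qBinomialCoeff, qPochhammer_succ, qPochhammer_succ, pow_succ',
    div_mul_eq_mul_div, div_mul_eq_mul_div, div_eq_div_iff (mul_ne_zero h1 h2) h1]
  ring

/-- The remainder is kept explicit so that one identity serves twice: it tends to zero for the
convergent series, and it vanishes for `A = q^{-n}`, `M = n + 1`. -/
theorem qBinomial_partial_sum {A q : ℝ} (hq0 : 0 < q) (hq1 : q < 1) (z : ℝ) (M : ℕ) :
    (1 - z) * ∑ k ∈ Finset.range M, qBinomialCoeff A q k * z ^ k =
      (1 - A * z) * ∑ k ∈ Finset.range M, qBinomialCoeff A q k * (q * z) ^ k -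
        qBinomialCoeff A q M * (1 - q ^ M) * z ^ M := by
  induction M with
  | zero => simp
  | succ M ih =>
    rw [Finset.sum_range_succ, Finset.sum_range_succ, mul_add, ih, qBinomialCoeff_succ hq0 hq1]
    ring

theorem summable_qBinomial {A q : ℝ} (hA : A < 1) (hq0 : 0 < q) (hq1 : q < 1) {z : ℝ}
    (hz0 : 0 < z) (hz1 : z < 1) : Summable fun k => qBinomialCoeff A q k * z ^ k := by
  have hc : ∀ k, 0 < qBinomialCoeff A q k := fun k =>
    div_pos (qPochhammer_pos hA hq0.le hq1.le k) (qPochhammer_pos hq1 hq0.le hq1.le k)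
  refine summable_of_ratio_test_tendsto_lt_one (l := z) hz1
    (Filter.Eventually.of_forall fun k => (mul_pos (hc k) (pow_pos hz0 k)).ne') ?_
  have hqt := tendsto_pow_atTop_nhds_zero_of_lt_one hq0.le hq1
  have hlim : Filter.Tendsto (fun k : ℕ => (1 - A * q ^ k) / (1 - q ^ (k + 1)) * z)
      Filter.atTop (nhds z) := by
    have h1 := (hqt.const_mul A).const_sub 1
    have h2 := ((Filter.tendsto_add_atTop_iff_nat 1).2 hqt).const_sub 1
    simpa using (h1.div h2 (by norm_num)).mul_const z
  refine hlim.congr fun k => ?_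
  have hk : (0 : ℝ) < 1 - q ^ (k + 1) := sub_pos.2 (pow_lt_one₀ hq0.le hq1 (by omega))
  have := qBinomialCoeff_succ (A := A) hq0 hq1 k
  rw [Real.norm_of_nonneg (mul_pos (hc _) (pow_pos hz0 _)).le,
    Real.norm_of_nonneg (mul_pos (hc _) (pow_pos hz0 _)).le, div_mul_eq_mul_div,
    div_eq_div_iff hk.ne' (mul_pos (hc _) (pow_pos hz0 _)).ne']
  linear_combination (-(z ^ (k + 1))) * this

theorem qBinomial_functional_eq {A q : ℝ} (hA : A < 1) (hq0 : 0 < q) (hq1 : q < 1) {z : ℝ}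
    (hz0 : 0 < z) (hz1 : z < 1) :
    (1 - z) * ∑' k, qBinomialCoeff A q k * z ^ k =
      (1 - A * z) * ∑' k, qBinomialCoeff A q k * (q * z) ^ k := by
  have hs := summable_qBinomial hA hq0 hq1 hz0 hz1
  have hs' := summable_qBinomial hA hq0 hq1 (mul_pos hq0 hz0)
    (mul_lt_one_of_nonneg_of_lt_one_left hq0.le hq1 hz1.le)
  have hqt := tendsto_pow_atTop_nhds_zero_of_lt_one hq0.le hq1
  have h1 := hs.hasSum.tendsto_sum_nat.const_mul (1 - z)
  have h2 := (hs'.hasSum.tendsto_sum_nat.const_mul (1 - A * z)).sub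
    (hs.tendsto_atTop_zero.mul (hqt.const_sub 1))
  rw [zero_mul, sub_zero] at h2
  refine tendsto_nhds_unique h1 (h2.congr fun M => ?_)
  rw [qBinomial_partial_sum hq0 hq1]
  ring

theorem qPochhammer_neg_zpow_eq_zero {q : ℝ} (hq0 : 0 < q) (n : ℕ) :
    qPochhammer (q ^ (-(n : ℤ))) q (n + 1) = 0 := by
  rw [qPochhammer_succ, zpow_neg, zpow_natCast, inv_mul_cancel₀ (pow_pos hq0 n).ne']
  simp

/-- With no remainder, `(1 - z) F(z) = (1 - q^{-n} z) F(qz)`. The left factor kills `z = 1`, so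
`F(q) = 0`; the zero propagates along powers of `q` until `q^{-n} z = 1`. -/
theorem qBinomial_terminating_eq_zero {q : ℝ} (hq0 : 0 < q) (hq1 : q < 1) {n i : ℕ} (hi : i < n) :
    ∑ k ∈ Finset.range (n + 1), qBinomialCoeff (q ^ (-(n : ℤ))) q k * (q ^ (i + 1)) ^ k = 0 := by
  have key : ∀ z : ℝ, (1 - z) * ∑ k ∈ Finset.range (n + 1),
      qBinomialCoeff (q ^ (-(n : ℤ))) q k * z ^ k = (1 - q ^ (-(n : ℤ)) * z) *
      ∑ k ∈ Finset.range (n + 1), qBinomialCoeff (q ^ (-(n : ℤ))) q k * (q * z) ^ k := by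
    intro z
    rw [qBinomial_partial_sum hq0 hq1, qBinomialCoeff.eq_1 _ _ (n + 1),
      qPochhammer_neg_zpow_eq_zero hq0]
    ring
  induction i with
  | zero =>
    have h := key 1
    have hne : (1 - q ^ (-(n : ℤ)) * 1) ≠ 0 := by
      have : q ^ n < 1 := pow_lt_one₀ hq0.le hq1 (by omega)
      rw [mul_one, zpow_neg, zpow_natCast, sub_ne_zero]
      exact ((one_lt_inv₀ (pow_pos hq0 n)).2 this).ne
    rw [sub_self, zero_mul, eq_comm, mul_eq_zero] at h
    simpa using h.resolve_left hne
  | succ i ih =>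
    have h := key (q ^ (i + 1))
    have hne : (1 - q ^ (-(n : ℤ)) * q ^ (i + 1)) ≠ 0 := by
      rw [zpow_neg, zpow_natCast, sub_ne_zero, ne_comm, ← div_eq_inv_mul, Ne,
        div_eq_one_iff_eq (pow_pos hq0 n).ne']
      exact (pow_lt_pow_right_of_lt_one₀ hq0 hq1 hi).ne'
    rw [ih (by omega), mul_zero, eq_comm, mul_eq_zero] at h
    simpa [pow_succ'] using h.resolve_left hne

theorem qBinomial_terminating_eval_eq_zero {q : ℝ} (hq0 : 0 < q) (hq1 : q < 1) {n : ℕ} {S : ℝ[X]}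
    (hS : S.natDegree < n) :
    ∑ k ∈ Finset.range (n + 1),
      qBinomialCoeff (q ^ (-(n : ℤ))) q k * q ^ k * S.eval (q ^ k) = 0 := by
  simp only [eval_eq_sum_range, Finset.mul_sum]
  rw [Finset.sum_comm]
  refine Finset.sum_eq_zero fun i hi => ?_
  rw [Finset.mem_range] at hi
  have h := qBinomial_terminating_eq_zero hq0 hq1 (show i < n by omega)
  rw [← mul_zero (S.coeff i), ← h, Finset.mul_sum]
  refine Finset.sum_congr rfl fun k _ => ?_
  rw [← pow_mul, ← pow_mul, add_mul, pow_add, one_mul, mul_comm k i]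
  ring

/-! ### Gaussian quadrature and zeros of orthogonal polynomials -/

/-- Dividing `h` by the nodal polynomial leaves a quotient of degree below `n`, which orthogonality
kills, and a remainder recovered by Lagrange interpolation. Each weight is `L` of a squared Lagrange
basis polynomial, hence positive. -/
theorem exists_gauss_weights (L : ℝ[X] →ₗ[ℝ] ℝ) {n : ℕ} {P : ℝ[X]} {x : Fin n → ℝ}
    (hx : Function.Injective x) {c : ℝ} (hc : c ≠ 0) (hP : P = C c * ∏ i, (X - C (x i)))
    (horth : ∀ g : ℝ[X], g.degree < n → L (P * g) = 0) (hpos : ∀ g ≠ 0, 0 < L (g ^ 2)) :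
    ∃ l : Fin n → ℝ, (∀ i, 0 < l i) ∧
      ∀ h : ℝ[X], h.natDegree < 2 * n → L h = ∑ i, l i * h.eval (x i) := by
  set N : ℝ[X] := ∏ i, (X - C (x i)) with hN
  have hNm : N.Monic := monic_prod_of_monic _ _ fun i _ => monic_X_sub_C _
  have hNd : N.natDegree = n := by simp [hN, natDegree_prod_of_monic, monic_X_sub_C]
  have hNev : ∀ i, N.eval (x i) = 0 := fun i => by
    rw [hN, eval_prod]
    exact Finset.prod_eq_zero (Finset.mem_univ i) (by simp)
  have hNorth : ∀ g : ℝ[X], g.degree < n → L (N * g) = 0 := by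
    intro g hg
    have h := horth g hg
    rw [hP, mul_assoc, ← smul_eq_C_mul, map_smul, smul_eq_mul] at h
    exact (mul_eq_zero.1 h).resolve_left hc
  have hquad : ∀ h : ℝ[X], h.natDegree < 2 * n →
      L h = ∑ i, L (Lagrange.basis Finset.univ x i) * h.eval (x i) := by
    intro h hh
    have hdiv := modByMonic_add_div h N
    have hq : (h /ₘ N).degree < n := by
      by_cases h0 : h /ₘ N = 0
      · rw [h0, degree_zero]; exact WithBot.bot_lt_coe n
      · rw [degree_eq_natDegree h0, natDegree_divByMonic h hNm, hNd]
        exact_mod_cast (by omega : h.natDegree - n < n)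
    have hr : (h %ₘ N).degree < (Finset.univ : Finset (Fin n)).card := by
      simpa [degree_eq_natDegree hNm.ne_zero, hNd] using degree_modByMonic_lt h hNm
    have hev : ∀ i, (h %ₘ N).eval (x i) = h.eval (x i) := fun i => by
      conv_rhs => rw [← hdiv]
      simp [hNev]
    conv_lhs => rw [← hdiv, map_add, hNorth _ hq, add_zero,
      Lagrange.eq_interpolate hx.injOn hr, Lagrange.interpolate_apply, map_sum]
    refine Finset.sum_congr rfl fun i _ => ?_
    rw [← smul_eq_C_mul, map_smul, hev, smul_eq_mul, mul_comm]
  refine ⟨_, fun i => ?_, hquad⟩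
  have hb0 : Lagrange.basis Finset.univ x i ≠ 0 :=
    Lagrange.basis_ne_zero hx.injOn (Finset.mem_univ i)
  have hn : 0 < n := i.pos
  have h := hquad (Lagrange.basis Finset.univ x i ^ 2) (by
    rw [natDegree_pow, natDegree_eq_of_degree_eq_some
      (Lagrange.degree_basis hx.injOn (Finset.mem_univ i))]
    simp; omega)
  rw [Finset.sum_eq_single i] at h
  · rw [eval_pow, Lagrange.eval_basis_self hx.injOn (Finset.mem_univ i), one_pow, mul_one] at h
    exact h ▸ hpos _ hb0
  · intro j _ hj
    rw [eval_pow, Lagrange.eval_basis_of_ne hj.symm (Finset.mem_univ j)]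
    simp
  · simp

theorem exists_pow_eval_ne_zero {q : ℝ} (hq0 : 0 < q) (hq1 : q < 1) {p : ℝ[X]} (hp : p ≠ 0)
    (K : ℕ) : ∃ k, K < k ∧ p.eval (q ^ k) ≠ 0 := by
  by_contra! h
  refine hp (eq_zero_of_infinite_isRoot p ?_)
  have hinj : Function.Injective fun k : ℕ => q ^ (K + 1 + k) := fun i j hij => by
    have := pow_right_injective₀ hq0 hq1.ne hij
    omega
  refine (Set.infinite_range_of_injective hinj).mono ?_
  rintro _ ⟨k, rfl⟩
  exact h _ (by omega)

theorem summable_mul_eval_pow {q : ℝ} (hq0 : 0 < q) (hq1 : q < 1) {w : ℕ → ℝ} (hw : Summable w)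
    (p : ℝ[X]) : Summable fun k => w k * p.eval (q ^ k) := by
  obtain ⟨B, hB⟩ := isCompact_Icc.exists_bound_of_continuousOn (s := Set.Icc (0 : ℝ) 1)
    p.continuous.continuousOn
  refine Summable.of_norm_bounded (hw.abs.mul_right B) fun k => ?_
  rw [norm_mul, Real.norm_eq_abs (w k)]
  exact mul_le_mul_of_nonneg_left
    (hB _ ⟨pow_nonneg hq0.le k, pow_le_one₀ hq0.le hq1.le⟩) (abs_nonneg _)

/-- The functional `p ↦ ∑ₖ wₖ p(qᵏ)` for a summable weight on the lattice `{qᵏ}`. -/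
noncomputable def latticeFunctional {q : ℝ} (hq0 : 0 < q) (hq1 : q < 1) {w : ℕ → ℝ}
    (hw : Summable w) : ℝ[X] →ₗ[ℝ] ℝ where
  toFun p := ∑' k, w k * p.eval (q ^ k)
  map_add' p r := by
    rw [← (summable_mul_eval_pow hq0 hq1 hw p).tsum_add (summable_mul_eval_pow hq0 hq1 hw r)]
    simp only [eval_add, mul_add]
  map_smul' c p := by
    simp only [eval_smul, smul_eq_mul, RingHom.id_apply, ← tsum_mul_left]
    exact tsum_congr fun k => by ring

theorem latticeFunctional_apply {q : ℝ} (hq0 : 0 < q) (hq1 : q < 1) {w : ℕ → ℝ}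
    (hw : Summable w) (p : ℝ[X]) :
    latticeFunctional hq0 hq1 hw p = ∑' k, w k * p.eval (q ^ k) := rfl

theorem latticeFunctional_pos {q : ℝ} (hq0 : 0 < q) (hq1 : q < 1) {w : ℕ → ℝ}
    (hw : Summable w) (hw0 : ∀ k, 0 < w k) {p : ℝ[X]} (hp : p ≠ 0)
    (hp0 : ∀ k : ℕ, 0 ≤ p.eval (q ^ k)) : 0 < latticeFunctional hq0 hq1 hw p := by
  obtain ⟨k, -, hk⟩ := exists_pow_eval_ne_zero hq0 hq1 hp 0
  exact (summable_mul_eval_pow hq0 hq1 hw p).tsum_pos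
    (fun k => mul_nonneg (hw0 k).le (hp0 k)) k
    (mul_pos (hw0 k) (lt_of_le_of_ne (hp0 k) hk.symm))

/-- A smaller degree would make `P` orthogonal to itself. This spares computing the leading
coefficient. -/
theorem natDegree_eq_of_orthogonal {L : ℝ[X] →ₗ[ℝ] ℝ} (hpos : ∀ g ≠ 0, 0 < L (g ^ 2))
    {n : ℕ} {P : ℝ[X]} (hP : P ≠ 0) (hdeg : P.natDegree ≤ n)
    (horth : ∀ g : ℝ[X], g.degree < n → L (P * g) = 0) : P.natDegree = n := by
  refine hdeg.antisymm (not_lt.1 fun h => (hpos P hP).ne' ?_)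
  rw [sq]
  exact horth P ((natDegree_lt_iff_degree_lt hP).1 h)

/-- If `P = dQ`, then `deg Q < n` forces `L(PQ) = 0`, while `PQ = dQ²` is nonnegative on the
lattice. Suitable choices of `d` exclude nonreal, multiple and nonpositive zeros. -/
theorem not_dvd_of_orthogonal {q : ℝ} (hq0 : 0 < q) (hq1 : q < 1) {w : ℕ → ℝ}
    (hw : Summable w) (hw0 : ∀ k, 0 < w k) {n : ℕ} {P : ℝ[X]} (hP : P ≠ 0)
    (hdeg : P.natDegree = n)
    (horth : ∀ g : ℝ[X], g.degree < n → latticeFunctional hq0 hq1 hw (P * g) = 0)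
    {d : ℝ[X]} (hd : 0 < d.natDegree) (hd0 : ∀ k : ℕ, 0 ≤ d.eval (q ^ k)) : ¬ d ∣ P := by
  rintro ⟨Q, rfl⟩
  have hQ : Q ≠ 0 := right_ne_zero_of_mul hP
  have hd' : d ≠ 0 := left_ne_zero_of_mul hP
  rw [natDegree_mul hd' hQ] at hdeg
  have h := horth Q ((natDegree_lt_iff_degree_lt hQ).1 (by omega))
  refine (latticeFunctional_pos hq0 hq1 hw hw0 (mul_ne_zero hP hQ) fun k => ?_).ne' h
  rw [eval_mul, eval_mul, mul_assoc]
  exact mul_nonneg (hd0 k) (mul_self_nonneg _)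

theorem exists_zeros_of_orthogonal {q : ℝ} (hq0 : 0 < q) (hq1 : q < 1) {w : ℕ → ℝ}
    (hw : Summable w) (hw0 : ∀ k, 0 < w k) {n : ℕ} {P : ℝ[X]} (hP : P ≠ 0)
    (hdeg : P.natDegree = n)
    (horth : ∀ g : ℝ[X], g.degree < n → latticeFunctional hq0 hq1 hw (P * g) = 0) :
    ∃ x : Fin n → ℝ, StrictMono x ∧ (∀ i, 0 < x i) ∧
      P = C P.leadingCoeff * ∏ i, (X - C (x i)) := by
  have hnd := fun d => not_dvd_of_orthogonal hq0 hq1 hw hw0 hP hdeg horth (d := d)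
  have hsplit : P.Splits := by
    obtain ⟨c, hc⟩ := UniqueFactorizationMonoid.factors_prod hP
    rw [← hc]
    refine (Splits.multisetProd fun g hgf => ?_).mul c.isUnit.splits
    have hg := UniqueFactorizationMonoid.irreducible_of_factor g hgf
    have hgP := UniqueFactorizationMonoid.dvd_of_mem_factors hgf
    by_contra hne
    have hg0 : 0 < g.natDegree := hg.natDegree_pos
    have h2 : 1 < g.natDegree := by
      have : g.natDegree ≠ 1 := fun h => hne (Splits.of_natDegree_eq_one h)
      omega
    have hroot : ∀ z, g.eval z ≠ 0 := fun z hz =>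
      hg.not_isRoot_of_natDegree_ne_one h2.ne' hz
    have hsign : (∀ z, 0 ≤ g.eval z) ∨ ∀ z, 0 ≤ (-g).eval z := by
      by_contra! h
      obtain ⟨⟨y, hy⟩, z, hz⟩ := h
      rw [eval_neg, neg_lt_zero] at hz
      obtain ⟨t, ht⟩ := mem_range_of_exists_le_of_exists_ge g.continuous ⟨y, hy.le⟩ ⟨z, hz.le⟩
      exact hroot t ht
    rcases hsign with h | h
    · exact hnd g hg0 (fun k => h _) hgP
    · exact hnd (-g) (by rwa [natDegree_neg]) (fun k => h _) (by rwa [neg_dvd])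
  have hnodup : P.roots.Nodup := by
    rw [Multiset.nodup_iff_count_le_one]
    intro z
    rw [count_roots]
    by_contra! h
    refine hnd ((X - C z) ^ 2) (by simp) (fun k => ?_)
      ((pow_dvd_pow _ h).trans (pow_rootMultiplicity_dvd P z))
    rw [eval_pow]
    exact sq_nonneg _
  have hpos : ∀ z ∈ P.roots, 0 < z := by
    intro z hz
    by_contra! h
    refine hnd (X - C z) (by simp) (fun k => ?_) (dvd_iff_isRoot.2 (isRoot_of_mem_roots hz))
    have := pow_pos hq0 k
    simp only [eval_sub, eval_X, eval_C]
    linarith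
  have hcard : P.roots.toFinset.card = n := by
    rw [Multiset.toFinset_card_of_nodup hnodup, ← hdeg]
    exact hsplit.natDegree_eq_card_roots.symm
  refine ⟨P.roots.toFinset.orderEmbOfFin hcard, (P.roots.toFinset.orderEmbOfFin hcard).strictMono,
    fun i => hpos _ (Multiset.mem_toFinset.1 (Finset.orderEmbOfFin_mem _ hcard i)), ?_⟩
  conv_lhs => rw [hsplit.eq_prod_roots]
  congr 1
  have himg : P.roots.toFinset =
      Finset.univ.map (P.roots.toFinset.orderEmbOfFin hcard).toEmbedding := by
    apply Finset.coe_injective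
    simp
  calc (P.roots.map fun a => X - C a).prod = ∏ a ∈ P.roots.toFinset, (X - C a) := by
        rw [Finset.prod, Multiset.toFinset_val, hnodup.dedup]
    _ = _ := by
        conv_lhs => rw [himg]
        rw [Finset.prod_map]
        rfl

/-! ### Interlacing of zeros for comparable weights -/

theorem natDegree_X_sub_C_mul_sq_lt {n : ℕ} {f : ℝ[X]} (hf : f.natDegree < n) (c : ℝ) :
    ((X - C c) * f ^ 2).natDegree < 2 * n := by
  have h := natDegree_mul_le (p := X - C c) (q := f ^ 2)
  rw [natDegree_X_sub_C, natDegree_pow] at h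
  omega

/-- If the ratio of two weights on the lattice is monotone, then the form
`f ↦ ∑ (x - c) f²` for one weight is bounded below by a positive multiple of the one for the
other. -/
theorem exists_sum_sub_mul_le {q : ℝ} (hq0 : 0 < q) (hq1 : q < 1) {s t ρ : ℕ → ℝ}
    (hs : ∀ k, 0 ≤ s k) (hst : ∀ k, t k = s k * ρ k) (hρ : Antitone ρ) {c : ℝ} (hc : 0 < c) :
    ∃ K, q ^ K < c ∧ ∀ k, ρ K * (s k * (q ^ k - c)) ≤ t k * (q ^ k - c) := by
  classical
  have hex : ∃ K : ℕ, q ^ K < c := exists_pow_lt_of_lt_one hc hq1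
  -- `K` is where `q^k - c` turns negative, so `q^k - c` and `ρ k - ρ K` never have opposite signs.
  refine ⟨Nat.find hex, Nat.find_spec hex, fun k => ?_⟩
  have h : 0 ≤ (q ^ k - c) * (ρ k - ρ (Nat.find hex)) := by
    rcases lt_or_ge k (Nat.find hex) with hk | hk
    · exact mul_nonneg (sub_nonneg.2 (not_lt.1 (Nat.find_min hex hk))) (sub_nonneg.2 (hρ hk.le))
    · refine mul_nonneg_of_nonpos_of_nonpos ?_ (sub_nonpos.2 (hρ hk))
      have := pow_le_pow_of_le_one hq0.le hq1.le hk
      linarith [Nat.find_spec hex]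
  rw [hst]
  nlinarith [mul_nonneg (hs k) h]

section Interlacing

variable {q : ℝ} {hq0 : 0 < q} {hq1 : q < 1} {u v : ℕ → ℝ} {hu : Summable u} {hv : Summable v}

theorem prod_X_sub_C_ne_zero {ι : Type*} (s : Finset ι) (x : ι → ℝ) :
    ∏ i ∈ s, (X - C (x i)) ≠ 0 :=
  Finset.prod_ne_zero_iff.2 fun i _ => X_sub_C_ne_zero (x i)

theorem natDegree_prod_X_sub_C_eq_card {ι : Type*} (s : Finset ι) (x : ι → ℝ) :
    (∏ i ∈ s, (X - C (x i))).natDegree = s.card := by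
  rw [natDegree_prod_of_monic _ _ fun i _ => monic_X_sub_C _]
  simp

theorem eval_prod_X_sub_C_eq_zero {ι : Type*} {s : Finset ι} (x : ι → ℝ) {i : ι} (hi : i ∈ s) :
    (∏ j ∈ s, (X - C (x j))).eval (x i) = 0 := by
  rw [eval_prod]
  exact Finset.prod_eq_zero hi (by simp)

theorem latticeFunctional_X_sub_C_mul (hq0 : 0 < q) (hq1 : q < 1) (hu : Summable u) (c : ℝ)
    (p : ℝ[X]) : latticeFunctional hq0 hq1 hu ((X - C c) * p) =
      latticeFunctional hq0 hq1 hu (X * p) - c * latticeFunctional hq0 hq1 hu p := by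
  rw [sub_mul, map_sub, ← smul_eq_C_mul, map_smul, smul_eq_mul]

/-- The test polynomial `f`, of degree `n - 1`, leaves only nodes `≥ x_i` for `u` and only nodes `≤
y_i` for `v`. Hence `L_u((x - x_i)f²) ≥ 0 ≥ L_v((x - y_i)f²)`; the monotone ratio carries the first
inequality to `v`, strictly, and `L_v(f²) > 0` gives the order. -/
theorem zero_lt_zero_of_weight_ratio (hu0 : ∀ k, 0 < u k) (hv0 : ∀ k, 0 < v k) {φ : ℕ → ℝ}
    (huv : ∀ k, v k = u k * φ k) (hφ : StrictAnti φ) {n : ℕ} {x y l m : Fin n → ℝ}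
    (hx : StrictMono x) (hy : StrictMono y) (hx0 : ∀ i, 0 < x i) (hl : ∀ i, 0 < l i)
    (hm : ∀ i, 0 < m i)
    (hL : ∀ h : ℝ[X], h.natDegree < 2 * n →
      latticeFunctional hq0 hq1 hu h = ∑ i, l i * h.eval (x i))
    (hM : ∀ h : ℝ[X], h.natDegree < 2 * n →
      latticeFunctional hq0 hq1 hv h = ∑ i, m i * h.eval (y i)) (i : Fin n) :
    x i < y i := by
  set f : ℝ[X] := (∏ j ∈ Finset.Iio i, (X - C (x j))) * ∏ j ∈ Finset.Ioi i, (X - C (y j)) with hf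
  have hf0 : f ≠ 0 := mul_ne_zero (prod_X_sub_C_ne_zero _ _) (prod_X_sub_C_ne_zero _ _)
  have hfd : f.natDegree < n := by
    rw [hf, natDegree_mul (prod_X_sub_C_ne_zero _ _) (prod_X_sub_C_ne_zero _ _),
      natDegree_prod_X_sub_C_eq_card, natDegree_prod_X_sub_C_eq_card, Fin.card_Iio, Fin.card_Ioi]
    omega
  have h1 : 0 ≤ latticeFunctional hq0 hq1 hu ((X - C (x i)) * f ^ 2) := by
    rw [hL _ (natDegree_X_sub_C_mul_sq_lt hfd _)]
    refine Finset.sum_nonneg fun j _ => mul_nonneg (hl j).le ?_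
    simp only [eval_mul, eval_sub, eval_X, eval_C, eval_pow]
    rcases lt_or_ge j i with hji | hji
    · simp [hf, eval_prod_X_sub_C_eq_zero x (Finset.mem_Iio.2 hji)]
    · exact mul_nonneg (sub_nonneg.2 (hx.monotone hji)) (sq_nonneg _)
  have h2 : latticeFunctional hq0 hq1 hv ((X - C (y i)) * f ^ 2) ≤ 0 := by
    rw [hM _ (natDegree_X_sub_C_mul_sq_lt hfd _)]
    refine Finset.sum_nonpos fun j _ => mul_nonpos_of_nonneg_of_nonpos (hm j).le ?_
    simp only [eval_mul, eval_sub, eval_X, eval_C, eval_pow]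
    rcases lt_or_ge i j with hji | hji
    · simp [hf, eval_prod_X_sub_C_eq_zero y (Finset.mem_Ioi.2 hji)]
    · exact mul_nonpos_of_nonpos_of_nonneg (sub_nonpos.2 (hy.monotone hji)) (sq_nonneg _)
  have hφ0 : ∀ k, 0 < φ k := fun k => by
    have := hv0 k
    rw [huv] at this
    exact pos_of_mul_pos_right this (hu0 k).le
  have h3 : 0 < latticeFunctional hq0 hq1 hv ((X - C (x i)) * f ^ 2) := by
    obtain ⟨K, hK, hle⟩ := exists_sum_sub_mul_le hq0 hq1 (fun k => (hu0 k).le) huv hφ.antitone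
      (hx0 i)
    -- Strictness comes from one lattice point beyond `K` at which `f` does not vanish.
    obtain ⟨k, hk, hfk⟩ := exists_pow_eval_ne_zero hq0 hq1 hf0 K
    refine (mul_nonneg (hφ0 K).le h1).trans_lt ?_
    rw [latticeFunctional_apply, latticeFunctional_apply, ← tsum_mul_left]
    refine Summable.tsum_lt_tsum (i := k) (fun k => ?_) ?_
      ((summable_mul_eval_pow hq0 hq1 hu _).mul_left _) (summable_mul_eval_pow hq0 hq1 hv _)
    · simp only [eval_mul, eval_sub, eval_X, eval_C, eval_pow]
      nlinarith [mul_le_mul_of_nonneg_right (hle k) (sq_nonneg (f.eval (q ^ k)))]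
    · simp only [eval_mul, eval_sub, eval_X, eval_C, eval_pow]
      have hqk : q ^ k < x i := (pow_le_pow_of_le_one hq0.le hq1.le hk.le).trans_lt hK
      rw [huv]
      have : 0 < u k * ((φ K - φ k) * (x i - q ^ k)) * f.eval (q ^ k) ^ 2 :=
        mul_pos (mul_pos (hu0 k) (mul_pos (sub_pos.2 (hφ hk)) (sub_pos.2 hqk)))
          (sq_pos_iff.2 hfk)
      nlinarith
  have h4 := latticeFunctional_pos hq0 hq1 hv hv0 (pow_ne_zero 2 hf0)
    fun k => by rw [eval_pow]; exact sq_nonneg _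
  rw [latticeFunctional_X_sub_C_mul] at h2 h3
  by_contra! h
  nlinarith [mul_le_mul_of_nonneg_right h h4.le]

/-- Here `h` skips the two indices `i`, `i'`, so its degree is `n - 2`, leaving room for the factors
`A` and `B` in the test polynomials `Ah` for `u` and `Bh` for `v`. -/
theorem zero_lt_next_zero_of_weight_ratio (hu0 : ∀ k, 0 < u k) (hv0 : ∀ k, 0 < v k) {ψ : ℕ → ℝ}
    (hψ0 : ∀ k, 0 < ψ k) (hψ : Monotone ψ) {A B : ℝ[X]} (hA : A.natDegree ≤ 1)
    (hB : B.natDegree ≤ 1) (hB0 : B ≠ 0) (hA0 : ∀ z, 0 < z → A.eval z ≠ 0)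
    (huv : ∀ k, v k * B.eval (q ^ k) ^ 2 = u k * A.eval (q ^ k) ^ 2 * ψ k)
    {n : ℕ} {x y l m : Fin n → ℝ}
    (hx : StrictMono x) (hy : StrictMono y) (hx0 : ∀ i, 0 < x i) (hl : ∀ i, 0 < l i)
    (hm : ∀ i, 0 < m i)
    (hL : ∀ h : ℝ[X], h.natDegree < 2 * n →
      latticeFunctional hq0 hq1 hu h = ∑ i, l i * h.eval (x i))
    (hM : ∀ h : ℝ[X], h.natDegree < 2 * n →
      latticeFunctional hq0 hq1 hv h = ∑ i, m i * h.eval (y i)) {i i' : Fin n}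
    (hii' : (i : ℕ) + 1 = i') : y i < x i' := by
  set h : ℝ[X] := (∏ j ∈ Finset.Iio i, (X - C (y j))) * ∏ j ∈ Finset.Ioi i', (X - C (x j)) with hh
  have hh0 : h ≠ 0 := mul_ne_zero (prod_X_sub_C_ne_zero _ _) (prod_X_sub_C_ne_zero _ _)
  have hhd : h.natDegree + 1 < n := by
    rw [hh, natDegree_mul (prod_X_sub_C_ne_zero _ _) (prod_X_sub_C_ne_zero _ _),
      natDegree_prod_X_sub_C_eq_card, natDegree_prod_X_sub_C_eq_card, Fin.card_Iio, Fin.card_Ioi]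
    omega
  have hgd : (A * h).natDegree < n := by
    have := natDegree_mul_le (p := A) (q := h)
    omega
  have hfd : (B * h).natDegree < n := by
    have := natDegree_mul_le (p := B) (q := h)
    omega
  have hf0 : B * h ≠ 0 := mul_ne_zero hB0 hh0
  have h1 : latticeFunctional hq0 hq1 hu ((X - C (x i')) * (A * h) ^ 2) < 0 := by
    rw [hL _ (natDegree_X_sub_C_mul_sq_lt hgd _)]
    have hle : ∀ j, l j * eval (x j) ((X - C (x i')) * (A * h) ^ 2) ≤ 0 := by
      intro j
      refine mul_nonpos_of_nonneg_of_nonpos (hl j).le ?_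
      simp only [eval_mul, eval_sub, eval_X, eval_C, eval_pow]
      rcases lt_or_ge i' j with hji | hji
      · simp [hh, eval_prod_X_sub_C_eq_zero x (Finset.mem_Ioi.2 hji)]
      · exact mul_nonpos_of_nonpos_of_nonneg (sub_nonpos.2 (hx.monotone hji)) (sq_nonneg _)
    -- Equality would make `h` vanish at the `n - 1` nodes other than `x i'`, one more than its
    -- degree.
    refine (Finset.sum_nonpos fun j _ => hle j).lt_of_ne fun hsum => hh0 ?_
    rw [Finset.sum_eq_zero_iff_of_nonpos fun j _ => hle j] at hsum
    refine eq_zero_of_natDegree_lt_card_of_eval_eq_zero' h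
      ((Finset.univ.erase i').image x) ?_ ?_
    · simp only [Finset.mem_image, Finset.mem_erase, Finset.mem_univ, and_true]
      rintro _ ⟨j, hj, rfl⟩
      have := hsum j (Finset.mem_univ j)
      simpa [(hl j).ne', sub_eq_zero, hx.injective.eq_iff, hj, hA0 _ (hx0 j)] using this
    · rw [Finset.card_image_of_injective _ hx.injective,
        Finset.card_erase_of_mem (Finset.mem_univ _), Finset.card_univ, Fintype.card_fin]
      omega
  have h2 : 0 ≤ latticeFunctional hq0 hq1 hv ((X - C (y i)) * (B * h) ^ 2) := by
    rw [hM _ (natDegree_X_sub_C_mul_sq_lt hfd _)]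
    refine Finset.sum_nonneg fun j _ => mul_nonneg (hm j).le ?_
    simp only [eval_mul, eval_sub, eval_X, eval_C, eval_pow]
    rcases lt_or_ge j i with hji | hji
    · simp [hh, eval_prod_X_sub_C_eq_zero y (Finset.mem_Iio.2 hji)]
    · exact mul_nonneg (sub_nonneg.2 (hy.monotone hji)) (sq_nonneg _)
  have h3 : latticeFunctional hq0 hq1 hv ((X - C (x i')) * (B * h) ^ 2) < 0 := by
    -- Negating both `ψ` and the target weight turns the antitone comparison into the upper bound
    -- wanted here.
    have hψ' : Antitone fun k => -ψ k := fun _ _ hab => neg_le_neg (hψ hab)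
    obtain ⟨K, -, hle⟩ := exists_sum_sub_mul_le hq0 hq1
      (s := fun k => u k * A.eval (q ^ k) ^ 2) (t := fun k => -(v k * B.eval (q ^ k) ^ 2))
      (fun k => mul_nonneg (hu0 k).le (sq_nonneg _)) (fun k => by rw [huv]; ring) hψ' (hx0 i')
    refine lt_of_le_of_lt ?_ (mul_neg_of_pos_of_neg (hψ0 K) h1)
    rw [latticeFunctional_apply, latticeFunctional_apply, ← tsum_mul_left]
    refine Summable.tsum_le_tsum (fun k => ?_) (summable_mul_eval_pow hq0 hq1 hv _)
      ((summable_mul_eval_pow hq0 hq1 hu _).mul_left _)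
    simp only [eval_mul, eval_sub, eval_X, eval_C, eval_pow]
    nlinarith [mul_le_mul_of_nonneg_right (hle k) (sq_nonneg (h.eval (q ^ k)))]
  have h4 := latticeFunctional_pos hq0 hq1 hv hv0 (pow_ne_zero 2 hf0)
    fun k => by rw [eval_pow]; exact sq_nonneg _
  rw [latticeFunctional_X_sub_C_mul] at h2 h3
  by_contra! h
  nlinarith [mul_le_mul_of_nonneg_right h h4.le]

theorem strictlyInterlaces_of_weight_ratio (hu0 : ∀ k, 0 < u k) (hv0 : ∀ k, 0 < v k)
    {φ ψ : ℕ → ℝ} (hφ : StrictAnti φ) (hφuv : ∀ k, v k = u k * φ k)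
    (hψ0 : ∀ k, 0 < ψ k) (hψ : Monotone ψ) {A B : ℝ[X]} (hA : A.natDegree ≤ 1)
    (hB : B.natDegree ≤ 1) (hB0 : B ≠ 0) (hA0 : ∀ z, 0 < z → A.eval z ≠ 0)
    (hψuv : ∀ k, v k * B.eval (q ^ k) ^ 2 = u k * A.eval (q ^ k) ^ 2 * ψ k)
    {n : ℕ} {P R : ℝ[X]} (hP : P ≠ 0) (hPd : P.natDegree ≤ n)
    (hPo : ∀ g : ℝ[X], g.degree < n → latticeFunctional hq0 hq1 hu (P * g) = 0)
    (hR : R ≠ 0) (hRd : R.natDegree ≤ n)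
    (hRo : ∀ g : ℝ[X], g.degree < n → latticeFunctional hq0 hq1 hv (R * g) = 0) :
    StrictlyInterlaces P R := by
  have hupos : ∀ g : ℝ[X], g ≠ 0 → 0 < latticeFunctional hq0 hq1 hu (g ^ 2) := fun g hg =>
    latticeFunctional_pos hq0 hq1 hu hu0 (pow_ne_zero 2 hg)
      fun k => by rw [eval_pow]; exact sq_nonneg _
  have hvpos : ∀ g : ℝ[X], g ≠ 0 → 0 < latticeFunctional hq0 hq1 hv (g ^ 2) := fun g hg =>
    latticeFunctional_pos hq0 hq1 hv hv0 (pow_ne_zero 2 hg)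
      fun k => by rw [eval_pow]; exact sq_nonneg _
  obtain ⟨x, hx, hx0, hPx⟩ := exists_zeros_of_orthogonal hq0 hq1 hu hu0 hP
    (natDegree_eq_of_orthogonal hupos hP hPd hPo) hPo
  obtain ⟨y, hy, hy0, hRy⟩ := exists_zeros_of_orthogonal hq0 hq1 hv hv0 hR
    (natDegree_eq_of_orthogonal hvpos hR hRd hRo) hRo
  obtain ⟨l, hl, hL⟩ := exists_gauss_weights _ hx.injective (leadingCoeff_ne_zero.2 hP) hPx hPo
    hupos
  obtain ⟨m, hm, hM⟩ := exists_gauss_weights _ hy.injective (leadingCoeff_ne_zero.2 hR) hRy hRo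
    hvpos
  exact Or.inl ⟨n, x, y, ⟨hP, hx.monotone, hPx⟩, ⟨hR, hy.monotone, hRy⟩,
    zero_lt_zero_of_weight_ratio hu0 hv0 hφuv hφ hx hy hx0 hl hm hL hM,
    fun i j hij => zero_lt_next_zero_of_weight_ratio hu0 hv0 hψ0 hψ hA hB hB0 hA0 hψuv hx hy
      hx0 hl hm hL hM hij⟩

end Interlacing

/-! ### Orthogonality of the little `q`-Jacobi polynomials -/

theorem qBinomialCoeff_pos {A q : ℝ} (hA : A < 1) (hq0 : 0 < q) (hq1 : q < 1) (k : ℕ) :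
    0 < qBinomialCoeff A q k :=
  div_pos (qPochhammer_pos hA hq0.le hq1.le k) (qPochhammer_pos hq1 hq0.le hq1.le k)

/-- The functional equation at `z = αq^j` relates consecutive moments, so moments are known up to
the total mass, without summing the `q`-binomial series. -/
theorem latticeFunctional_X_pow {q α β : ℝ} (hq0 : 0 < q) (hq1 : q < 1) (hα0 : 0 < α)
    (hα1 : α < 1) (hβ : β < 1) (j : ℕ) :
    latticeFunctional hq0 hq1 (summable_qBinomial hβ hq0 hq1 hα0 hα1) (X ^ j) *
      qPochhammer (α * β) q j =
    latticeFunctional hq0 hq1 (summable_qBinomial hβ hq0 hq1 hα0 hα1) 1 * qPochhammer α q j := by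
  have hval : ∀ j : ℕ, latticeFunctional hq0 hq1 (summable_qBinomial hβ hq0 hq1 hα0 hα1) (X ^ j) =
      ∑' k, qBinomialCoeff β q k * (α * q ^ j) ^ k := by
    intro j
    rw [latticeFunctional_apply]
    refine tsum_congr fun k => ?_
    rw [eval_pow, eval_X, mul_pow, ← pow_mul, ← pow_mul, mul_comm j k, mul_assoc]
  induction j with
  | zero => simp [qPochhammer_zero]
  | succ j ih =>
    have h := qBinomial_functional_eq hβ hq0 hq1 (mul_pos hα0 (pow_pos hq0 j))
      (mul_pow_lt_one_of_lt_one hα1 hq0.le hq1.le j)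
    rw [show q * (α * q ^ j) = α * q ^ (j + 1) by ring, ← hval, ← hval] at h
    rw [qPochhammer_succ, qPochhammer_succ]
    linear_combination (1 - α * q ^ j) * ih - qPochhammer (α * β) q j * h

theorem eval_prod_one_sub_C_mul_X (c q y : ℝ) (m : ℕ) :
    (∏ i ∈ Finset.range m, (1 - C (c * q ^ i) * X)).eval y = qPochhammer (c * y) q m := by
  rw [eval_prod, qPochhammer]
  refine Finset.prod_congr rfl fun i _ => ?_
  simp only [eval_sub, eval_one, eval_mul, eval_C, eval_X]
  ring

theorem natDegree_prod_one_sub_C_mul_X_le (c q : ℝ) (m : ℕ) :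
    (∏ i ∈ Finset.range m, (1 - C (c * q ^ i) * X) : ℝ[X]).natDegree ≤ m := by
  refine (natDegree_prod_le _ _).trans ((Finset.sum_le_card_nsmul _ _ 1 fun i _ => ?_).trans ?_)
  · refine (natDegree_sub_le _ _).trans (max_le (by simp) ((natDegree_C_mul_le _ _).trans natDegree_X_le))
  · simp

theorem littleQJacobi_orthogonal_X_pow {q a b : ℝ} (hq0 : 0 < q) (hq1 : q < 1) (ha0 : 0 < a * q)
    (ha1 : a * q < 1) (hb : b * q < 1) {n j : ℕ} (hj : j < n) :
    latticeFunctional hq0 hq1 (summable_qBinomial hb hq0 hq1 ha0 ha1)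
      (littleQJacobi n a b q * X ^ j) = 0 := by
  obtain ⟨N, rfl⟩ : ∃ N, n = N + 1 := ⟨n - 1, by omega⟩
  set L := latticeFunctional hq0 hq1 (summable_qBinomial hb hq0 hq1 ha0 ha1) with hL
  set α := a * q with hα
  set β := b * q with hβ
  have hαβ : α * β < 1 := by nlinarith
  have hab : a * b * q ^ (N + 1 + 1) = α * β * q ^ N := by rw [hα, hβ]; ring
  -- `S(q^k) = (αq^k;q)_j (αβq^{j+k};q)_{N-j}` is what remains of the `k`-th term once Pochhammer
  -- symbols cancel. Its degree is at most `N = n - 1`, so the terminating sum annihilates it.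
  set S : ℝ[X] := (∏ i ∈ Finset.range j, (1 - C (α * q ^ i) * X)) *
    ∏ i ∈ Finset.range (N - j), (1 - C (α * β * q ^ j * q ^ i) * X) with hS
  have hSd : S.natDegree < N + 1 := by
    have h1 := natDegree_prod_one_sub_C_mul_X_le α q j
    have h2 := natDegree_prod_one_sub_C_mul_X_le (α * β * q ^ j) q (N - j)
    have h3 : S.natDegree ≤ _ := natDegree_mul_le
    omega
  have hterm : ∀ k, qPochhammer (α * β * q ^ N) q k / qPochhammer α q k * L (X ^ (j + k)) =
      L 1 / qPochhammer (α * β) q N * S.eval (q ^ k) := by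
    intro k
    have hm := latticeFunctional_X_pow hq0 hq1 ha0 ha1 hb (j + k)
    have e1 : qPochhammer α q (j + k) = qPochhammer α q k * qPochhammer (α * q ^ k) q j := by
      rw [add_comm, qPochhammer_add]
    have e2 : qPochhammer (α * β) q N * qPochhammer (α * β * q ^ N) q k =
        qPochhammer (α * β) q (j + k) * qPochhammer (α * β * q ^ j * q ^ k) q (N - j) := by
      rw [← qPochhammer_add, mul_assoc (α * β), ← pow_add, ← qPochhammer_add]
      congr 1
      omega
    have p1 := (qPochhammer_pos ha1 hq0.le hq1.le k).ne'
    have p2 := (qPochhammer_pos hαβ hq0.le hq1.le N).ne'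
    have p3 := (qPochhammer_pos hαβ hq0.le hq1.le (j + k)).ne'
    rw [hS, eval_mul, eval_prod_one_sub_C_mul_X, eval_prod_one_sub_C_mul_X, div_mul_eq_mul_div,
      div_mul_eq_mul_div, div_eq_div_iff p1 p2]
    rw [← hL, e1] at hm
    linear_combination L (X ^ (j + k)) * e2 +
      qPochhammer (α * β * q ^ j * q ^ k) q (N - j) * hm
  rw [littleQJacobi, qHyp21, Finset.sum_mul, map_sum, ← mul_zero (L 1 / qPochhammer (α * β) q N),
    ← qBinomial_terminating_eval_eq_zero hq0 hq1 hSd, Finset.mul_sum]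
  refine Finset.sum_congr rfl fun k _ => ?_
  rw [hab, mul_pow, ← C_pow, ← mul_assoc, ← C_mul, mul_assoc, ← pow_add, ← smul_eq_C_mul, map_smul,
    smul_eq_mul, add_comm k j,
    mul_left_comm (L 1 / _) (qBinomialCoeff _ _ _ * _), ← hterm, qBinomialCoeff]
  ring

theorem littleQJacobi_orthogonal {q a b : ℝ} (hq0 : 0 < q) (hq1 : q < 1) (ha0 : 0 < a * q)
    (ha1 : a * q < 1) (hb : b * q < 1) {n : ℕ} (g : ℝ[X]) (hg : g.degree < n) :
    latticeFunctional hq0 hq1 (summable_qBinomial hb hq0 hq1 ha0 ha1)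
      (littleQJacobi n a b q * g) = 0 := by
  rw [g.as_sum_range_C_mul_X_pow, Finset.mul_sum, map_sum]
  refine Finset.sum_eq_zero fun j _ => ?_
  rw [mul_left_comm, ← smul_eq_C_mul, map_smul]
  rcases lt_or_ge j n with hj | hj
  · rw [littleQJacobi_orthogonal_X_pow hq0 hq1 ha0 ha1 hb hj, smul_zero]
  · rw [coeff_eq_zero_of_degree_lt (hg.trans_le (by exact_mod_cast hj)), zero_smul]

theorem natDegree_littleQJacobi_le (n : ℕ) (a b q : ℝ) :
    (littleQJacobi n a b q).natDegree ≤ n := by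
  rw [littleQJacobi, qHyp21]
  refine natDegree_sum_le_of_forall_le _ _ fun k hk => ?_
  rw [mul_pow, ← C_pow, ← mul_assoc, ← C_mul]
  exact (natDegree_C_mul_X_pow_le _ _).trans (Nat.lt_succ_iff.1 (Finset.mem_range.1 hk))

theorem littleQJacobi_ne_zero (n : ℕ) (a b q : ℝ) : littleQJacobi n a b q ≠ 0 := by
  intro h
  have h1 : (littleQJacobi n a b q).eval 0 = 1 := by
    rw [littleQJacobi, qHyp21, eval_finsetSum, Finset.sum_range_succ']
    simp [qPochhammer_zero]
  simp [h] at h1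

/-! ### Interlacing of little `q`-Jacobi polynomials -/

/-- Since `u_{k+1}/u_k = aq(1 - bq^{k+1})/(1 - q^{k+1})`, the denominator cancels in `v/u`; `hφ` and
`hψ` are the one-step forms of the two monotonicity conditions. -/
theorem littleQJacobi_strictlyInterlaces {q a b a' b' : ℝ} (hq0 : 0 < q) (hq1 : q < 1)
    (ha0 : 0 < a * q) (ha1 : a * q < 1) (hb : b * q < 1) (ha0' : 0 < a' * q) (ha1' : a' * q < 1)
    (hb' : b' * q < 1) {A B : ℝ[X]} (hA : A.natDegree ≤ 1) (hB : B.natDegree ≤ 1) (hB0 : B ≠ 0)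
    (hA0 : ∀ z, 0 < z → A.eval z ≠ 0) (hBq : ∀ k : ℕ, B.eval (q ^ k) ≠ 0)
    (hφ : ∀ k : ℕ, a' * q * (1 - b' * q * q ^ k) < a * q * (1 - b * q * q ^ k))
    (hψ : ∀ k : ℕ, a * q * (1 - b * q * q ^ k) *
        (A.eval (q ^ (k + 1)) * B.eval (q ^ k)) ^ 2 ≤
      a' * q * (1 - b' * q * q ^ k) * (A.eval (q ^ k) * B.eval (q ^ (k + 1))) ^ 2) (n : ℕ) :
    StrictlyInterlaces (littleQJacobi n a b q) (littleQJacobi n a' b' q) := by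
  have hA0' : ∀ k : ℕ, A.eval (q ^ k) ≠ 0 := fun k => hA0 _ (pow_pos hq0 k)
  have hu0 : ∀ k, 0 < qBinomialCoeff (b * q) q k * (a * q) ^ k := fun k =>
    mul_pos (qBinomialCoeff_pos hb hq0 hq1 k) (pow_pos ha0 k)
  have hv0 : ∀ k, 0 < qBinomialCoeff (b' * q) q k * (a' * q) ^ k := fun k =>
    mul_pos (qBinomialCoeff_pos hb' hq0 hq1 k) (pow_pos ha0' k)
  set u : ℕ → ℝ := fun k => qBinomialCoeff (b * q) q k * (a * q) ^ k with hu
  set v : ℕ → ℝ := fun k => qBinomialCoeff (b' * q) q k * (a' * q) ^ k with hv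
  have hsucc : ∀ α β : ℝ, ∀ k : ℕ,
      qBinomialCoeff β q (k + 1) * α ^ (k + 1) * (1 - q ^ (k + 1)) =
        qBinomialCoeff β q k * α ^ k * (α * (1 - β * q ^ k)) := fun α β k => by
    linear_combination α ^ (k + 1) * qBinomialCoeff_succ (A := β) hq0 hq1 k
  have hd : ∀ k : ℕ, 0 < 1 - q ^ (k + 1) := fun k =>
    sub_pos.2 (pow_lt_one₀ hq0.le hq1 k.succ_ne_zero)
  have hratio : ∀ k, v (k + 1) * u k * (a * q * (1 - b * q * q ^ k)) =
      v k * u (k + 1) * (a' * q * (1 - b' * q * q ^ k)) := by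
    intro k
    refine mul_right_cancel₀ (hd k).ne' ?_
    linear_combination u k * (a * q * (1 - b * q * q ^ k)) * hsucc (a' * q) (b' * q) k -
      v k * (a' * q * (1 - b' * q * q ^ k)) * hsucc (a * q) (b * q) k
  have hc : ∀ k : ℕ, 0 < a * q * (1 - b * q * q ^ k) := fun k =>
    mul_pos ha0 (sub_pos.2 (mul_pow_lt_one_of_lt_one hb hq0.le hq1.le k))
  have hc' : ∀ k : ℕ, 0 < a' * q * (1 - b' * q * q ^ k) := fun k =>
    mul_pos ha0' (sub_pos.2 (mul_pow_lt_one_of_lt_one hb' hq0.le hq1.le k))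
  refine strictlyInterlaces_of_weight_ratio (φ := fun k => v k / u k)
    (ψ := fun k => v k * B.eval (q ^ k) ^ 2 / (u k * A.eval (q ^ k) ^ 2)) hu0 hv0
    (strictAnti_nat_of_succ_lt fun k => ?_) (fun k => by rw [mul_div_cancel₀ _ (hu0 k).ne'])
    (fun k => div_pos (mul_pos (hv0 k) (sq_pos_iff.2 (hBq k)))
      (mul_pos (hu0 k) (sq_pos_iff.2 (hA0' k))))
    (monotone_nat_of_le_succ fun k => ?_) hA hB hB0 hA0
    (fun k => by rw [mul_div_cancel₀ _ (mul_pos (hu0 k) (sq_pos_iff.2 (hA0' k))).ne'])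
    (littleQJacobi_ne_zero _ _ _ _) (natDegree_littleQJacobi_le _ _ _ _)
    (littleQJacobi_orthogonal hq0 hq1 ha0 ha1 hb)
    (littleQJacobi_ne_zero _ _ _ _) (natDegree_littleQJacobi_le _ _ _ _)
    (littleQJacobi_orthogonal hq0 hq1 ha0' ha1' hb')
  · rw [div_lt_div_iff₀ (hu0 _) (hu0 _)]
    refine lt_of_mul_lt_mul_right ?_ (hc k).le
    rw [hratio]
    exact mul_lt_mul_of_pos_left (hφ k) (mul_pos (hv0 k) (hu0 (k + 1)))
  · rw [div_le_div_iff₀ (mul_pos (hu0 _) (sq_pos_iff.2 (hA0' _)))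
      (mul_pos (hu0 _) (sq_pos_iff.2 (hA0' _)))]
    refine le_of_mul_le_mul_right ?_ (hc k)
    have h := mul_le_mul_of_nonneg_left (hψ k) (mul_pos (hv0 k) (hu0 (k + 1))).le
    linear_combination h - (B.eval (q ^ (k + 1)) * A.eval (q ^ k)) ^ 2 * hratio k

theorem corollary1 (q a t₁ t₂ : ℝ) (hq0 : 0 < q) (hq1 : q < 1)
    (ha0 : 0 < a * q) (ha1 : a * q < 1)
    (ht₁ : q ^ 2 ≤ t₁) (ht₁' : t₁ ≤ 1) (ht₂ : q ^ 2 ≤ t₂) (ht₂' : t₂ ≤ 1)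
    (ht : t₁ * t₂ ≠ 1) (n : ℕ) :
    (∀ b : ℝ, 0 ≤ q * b → q * b < 1 → (b = 0 → t₂ ≠ 1) →
      StrictlyInterlaces (littleQJacobi n a (t₁ * b) q) (littleQJacobi n (t₂ * a) b q)) ∧
    (∀ b : ℝ, b < 0 → t₁ ≠ 1 →
      StrictlyInterlaces (littleQJacobi n a b q) (littleQJacobi n a (t₁ * b) q)) := by
  have hq2 : 0 < q ^ 2 := pow_pos hq0 2
  have ht₁0 : 0 < t₁ := hq2.trans_le ht₁
  have ht₂0 : 0 < t₂ := hq2.trans_le ht₂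
  have hfac : ∀ c : ℝ, (1 - C c * X : ℝ[X]).natDegree ≤ 1 := fun c =>
    (natDegree_sub_le _ _).trans (max_le (by simp) ((natDegree_C_mul_le _ _).trans natDegree_X_le))
  constructor
  · intro b hb0 hb1 hbt
    have hb0' : 0 ≤ b := nonneg_of_mul_nonneg_right hb0 hq0
    have hb1' : b * q < 1 := by rwa [mul_comm]
    have hbq : ∀ k : ℕ, 0 < 1 - b * q * q ^ k := fun k =>
      sub_pos.2 (mul_pow_lt_one_of_lt_one hb1' hq0.le hq1.le k)
    -- With `s = bq^{k+1}`, this choice turns `hψ` into `q²(1 - t₁s)(1 - s) ≤ t₂(1 - qs)²`. It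
    -- follows from `t₁, t₂ ≥ q²` and `(1 - qs)² - (1 - q²s)(1 - s) = s(1 - q)²`.
    refine littleQJacobi_strictlyInterlaces (A := X) (B := 1 - C (b * q) * X) hq0 hq1 ha0 ha1
      ?_ ?_ ?_ hb1' natDegree_X_le (hfac _) ?_ (fun z hz => by simpa using hz.ne') ?_ ?_ ?_ n
    · nlinarith
    · rw [mul_assoc]; exact mul_pos ht₂0 ha0
    · nlinarith
    · intro h
      simpa using congrArg (eval 0) h
    · intro k
      simpa using (hbq k).ne'
    · intro k
      have hx := pow_pos hq0 k
      have h1 := hbq k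
      have hbx : 0 ≤ b * q * q ^ k := by positivity
      suffices t₂ * (1 - b * q * q ^ k) < 1 - t₁ * (b * q * q ^ k) by nlinarith
      -- Strictness comes from `t₂ < 1`, or else from `t₁ < 1` together with `b > 0`.
      rcases ht₂'.lt_or_eq with h | h
      · nlinarith
      · have hb : 0 < b := lt_of_le_of_ne hb0' fun hb => hbt hb.symm h
        have h1 : t₁ < 1 := lt_of_le_of_ne ht₁' fun h1 => ht (by rw [h, h1, one_mul])
        have : 0 < b * q * q ^ k := by positivity
        nlinarith
    · intro k
      have h0 := hbq k
      have h1 := hbq (k + 1)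
      simp only [eval_X, eval_sub, eval_one, eval_mul, eval_C]
      rw [pow_succ q k] at h1 ⊢
      set x := q ^ k with hx
      set s := b * q * x with hs
      have hs0 : 0 ≤ s := by positivity
      have key : q ^ 2 * ((1 - t₁ * s) * (1 - s)) ≤ t₂ * (1 - s * q) ^ 2 := by
        have e1 : (1 - t₁ * s) * (1 - s) ≤ (1 - s * q) ^ 2 := by
          have : (1 - t₁ * s) * (1 - s) ≤ (1 - q ^ 2 * s) * (1 - s) :=
            mul_le_mul_of_nonneg_right (by nlinarith) h0.le
          nlinarith [mul_nonneg hs0 (sq_nonneg (1 - q))]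
        exact (mul_le_mul_of_nonneg_left e1 hq2.le).trans
          (mul_le_mul_of_nonneg_right ht₂ (sq_nonneg _))
      have hpos : 0 ≤ a * q * x ^ 2 * (1 - s) := by positivity
      have := mul_le_mul_of_nonneg_left key hpos
      have es : b * q * (x * q) = s * q := by rw [hs]; ring
      have et : t₁ * b * q * x = t₁ * s := by rw [hs]; ring
      rw [es, et]
      linear_combination this
  · intro b hb ht1
    have hbq' : b * q < 0 := mul_neg_of_neg_of_pos hb hq0
    -- For `b < 0` this `A` is positive on `z > 0`. With `s = -bq^{k+1}`, `hψ` becomes `(1 + qs)² ≤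
    -- (1 + t₁s)(1 + s)`, the same identity with `s` replaced by `-s`.
    refine littleQJacobi_strictlyInterlaces (A := 1 - C (b * q) * X) (B := 1) hq0 hq1 ha0 ha1
      (by linarith) ha0 ha1 (by nlinarith) (hfac _) (by simp) one_ne_zero ?_ (by simp) ?_ ?_ n
    · intro z hz
      have : 0 < 1 - b * q * z := by nlinarith
      simpa using this.ne'
    · intro k
      have h1 : t₁ < 1 := lt_of_le_of_ne ht₁' ht1
      have hbx : b * q * q ^ k < 0 := mul_neg_of_neg_of_pos hbq' (pow_pos hq0 k)
      refine mul_lt_mul_of_pos_left ?_ ha0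
      nlinarith
    · intro k
      simp only [eval_X, eval_sub, eval_one, eval_mul, eval_C, mul_one]
      rw [pow_succ q k]
      set x := q ^ k with hx
      have hx0 : 0 < x := pow_pos hq0 k
      obtain ⟨s, hs⟩ : ∃ s, s = -(b * q * x) := ⟨_, rfl⟩
      have hs0 : 0 < s := by rw [hs]; nlinarith [mul_neg_of_neg_of_pos hbq' hx0]
      have key : (1 + s * q) ^ 2 ≤ (1 + t₁ * s) * (1 + s) := by
        have : (1 + q ^ 2 * s) * (1 + s) ≤ (1 + t₁ * s) * (1 + s) :=
          mul_le_mul_of_nonneg_right (by nlinarith) (by linarith)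
        nlinarith [mul_nonneg hs0.le (sq_nonneg (1 - q))]
      have hpos : 0 ≤ a * q * (1 + s) := by positivity
      have := mul_le_mul_of_nonneg_left key hpos
      have es : b * q * (x * q) = -(s * q) := by rw [hs]; ring
      have et : t₁ * b * q * x = -(t₁ * s) := by rw [hs]; ring
      have e0 : b * q * x = -s := by rw [hs]; ring
      rw [es, et, e0]
      linear_combination this
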